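/- **Definitions.** Let $X$ be a metric space. A *geodesic* from $p$ to $q$ is a map $c:[0,l]\to X$ with $c(0)=p$, $c(l)=q$ and $d(c(s),c(t))=|s-t|$ for all $s,t$. The space $X$ is *CAT(1)* if any two points at distance $<\pi$ are joined by a geodesic, and for every geodesic triangle of perimeter $<2\pi$ the distance between any two points of the triangle is at most the distance between the corresponding points of the model triangle with the same side lengths in the unit sphere $S^2$. The *angle* between two geodesics issuing from a common point of a CAT(1) space is the greatest lower bound of the corresponding angles of the model triangles in $S^2$ for the triangles (of perimeter $<2\pi$) formed by nontrivial initial subsegments of the two geodesics and the third side. A *polygonal curve $\sigma$ inscribed in* $\gamma|_{[a,b]}$ is given by parameters $a=t_0<t_1<\dots<t_n=b$ with $\gamma(t_i)\ne\gamma(t_{i+1})$ and geodesic segments joining $\gamma(t_i)$ to $\gamma(t_{i+1})$. Its *total rotation* is $\tau_\sigma=\sum_i(\pi-\beta_i)$, where the $\beta_i$ are the angles at the interior vertices $\gamma(t_1),\dots,\gamma(t_{n-1})$, and its *mesh* is $\mu_\sigma=\max_i \operatorname{diam}\gamma([t_i,t_{i+1}])$. The *total curvature* of $\gamma|_{[a,b]}$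 is $$\tau_{\gamma|_{[a,b]}}=\limsup_{\mu_\sigma\to0}\tau_\sigma\in[0,\infty],$$ the limit superior being over all polygonal curves $\sigma$ inscribed in $\gamma|_{[a,b]}$. **Statement.** Let $X$ be a compact CAT(1) space and let $\gamma:[0,\infty)\to X$ be a curve parametrized by arclength, that is, the length of $\gamma|_{[s,t]}$ is $t-s$ for all $0\le s\le t$. Suppose that its total curvature function $\tau(t)=\tau_{\gamma|_{[0,t]}}$ has sublinear growth: $\tau(t)/t\to0$ as $t\to\infty$. Then there is a bilaterally infinite local geodesic $\rho:\mathbb R\to X$ (every $t\in\mathbb R$ has a neighbourhood on which $d(\rho(s),\rho(s'))=|s-s'|$) such that every finite segment of $\rho$ is a limit of segments of $\gamma$: for all $a\le b$ there are real numbers $u_1,u_2,\dots$ with $u_n+a\ge0$ such that $\gamma(u_n+s)\to\rho(s)$ as $n\to\infty$, uniformly in $s\in[a,b]$. -/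

import Mathlib

open Set Filter Topology
open scoped ENNReal

namespace CatOne

/-- The unit sphere in Euclidean 3-space, the model surface of constant curvature one. -/
abbrev UnitSphere : Type := Metric.sphere (0 : EuclideanSpace ℝ (Fin 3)) 1

/-- The intrinsic (great circle) distance on the unit sphere. -/
noncomputable def sphereDist (u v : UnitSphere) : ℝ :=
  InnerProductGeometry.angle (u : EuclideanSpace ℝ (Fin 3)) (v : EuclideanSpace ℝ (Fin 3))

section Metric

variable {X : Type*} [MetricSpace X]

/-- The restriction of `c` to `[0, l]` is a (unit speed) geodesic from `p` to `q`. -/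
structure IsGeodesicSegment (c : ℝ → X) (l : ℝ) (p q : X) : Prop where
  nonneg : 0 ≤ l
  source : c 0 = p
  target : c l = q
  dist_eq : ∀ s ∈ Icc 0 l, ∀ t ∈ Icc 0 l, dist (c s) (c t) = |s - t|

/-- `ρ : ℝ → X` is a bilaterally infinite local geodesic: every parameter value has a
neighbourhood on which `ρ` is a geodesic. -/
def IsLocalGeodesicLine (ρ : ℝ → X) : Prop :=
  ∀ t : ℝ, ∃ ε > 0, ∀ s ∈ Ioo (t - ε) (t + ε), ∀ s' ∈ Ioo (t - ε) (t + ε),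
    dist (ρ s) (ρ s') = |s - s'|

variable (X) in
/-- The `CAT(1)` condition: points at distance less than `π` are joined by a geodesic, and geodesic
triangles of perimeter less than `2π` are no thicker than their model triangles in the unit sphere.
In `comparison`, `c` and `c'` are two sides of the triangle, with `p` as common vertex, `x = c s`
and `y = c' s'` are points on them, and primed points are the corresponding points of the sphere.
(Any two sides share a vertex, and for two points on the same side the inequality is trivial.) -/
structure IsCAT1 : Prop where
  exists_geodesic : ∀ p q : X, dist p q < Real.pi →
    ∃ c : ℝ → X, IsGeodesicSegment c (dist p q) p q
  comparison : ∀ (p q r : X) (c c' : ℝ → X),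
    dist p q + dist q r + dist r p < 2 * Real.pi →
    IsGeodesicSegment c (dist p q) p q → IsGeodesicSegment c' (dist p r) p r →
    ∀ p' q' r' : UnitSphere,
    sphereDist p' q' = dist p q → sphereDist q' r' = dist q r → sphereDist r' p' = dist r p →
    ∀ s ∈ Icc 0 (dist p q), ∀ s' ∈ Icc 0 (dist p r),
    ∀ x' y' : UnitSphere,
    sphereDist p' x' = s → sphereDist x' q' = dist p q - s →
    sphereDist p' y' = s' → sphereDist y' r' = dist p r - s' →
    dist (c s) (c' s') ≤ sphereDist x' y'

/-- The angle, in a triangle of the unit sphere, between sides of lengths `a` and `b` when the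
third side has length `d` (spherical law of cosines). -/
noncomputable def modelAngle (a b d : ℝ) : ℝ :=
  Real.arccos ((Real.cos d - Real.cos a * Real.cos b) / (Real.sin a * Real.sin b))

/-- The angle at the common origin of two geodesics `c` on `[0, l]` and `c'` on `[0, l']` in a
`CAT(1)` space: the greatest lower bound of the model angles for the triangles formed by initial
subsegments of the two geodesics. -/
noncomputable def geodesicAngle (c : ℝ → X) (l : ℝ) (c' : ℝ → X) (l' : ℝ) : ℝ :=
  sInf {θ : ℝ | ∃ s ∈ Ioc 0 l, ∃ s' ∈ Ioc 0 l',
    s + s' + dist (c s) (c' s') < 2 * Real.pi ∧ θ = modelAngle s s' (dist (c s) (c' s'))}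

/-- A polygonal curve inscribed in `γ` restricted to `[a, b]`: parameter values
`a = t 0 < t 1 < ⋯ < t n = b`, and for each `i < n` a nondegenerate geodesic segment from
`γ (t i)` to `γ (t (i + 1))`. The values `t i` for `i > n` and `seg i` for `i ≥ n` are irrelevant. -/
structure InscribedPolygon (γ : ℝ → X) (a b : ℝ) where
  n : ℕ
  t : ℕ → ℝ
  seg : ℕ → ℝ → X
  start_eq : t 0 = a
  end_eq : t n = b
  lt_succ : ∀ i < n, t i < t (i + 1)
  ne_succ : ∀ i < n, γ (t i) ≠ γ (t (i + 1))
  isGeodesic : ∀ i < n,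
    IsGeodesicSegment (seg i) (dist (γ (t i)) (γ (t (i + 1)))) (γ (t i)) (γ (t (i + 1)))

namespace InscribedPolygon

variable {γ : ℝ → X} {a b : ℝ} (σ : InscribedPolygon γ a b)

/-- Length of the `i`-th segment. -/
noncomputable def segLength (i : ℕ) : ℝ := dist (γ (σ.t i)) (γ (σ.t (i + 1)))

/-- The angle at the vertex `γ (t (i + 1))`, between the `i`-th segment traversed backwards and
the `(i + 1)`-st segment. -/
noncomputable def vertexAngle (i : ℕ) : ℝ :=
  geodesicAngle (fun s => σ.seg i (σ.segLength i - s)) (σ.segLength i)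
    (σ.seg (i + 1)) (σ.segLength (i + 1))

/-- Total rotation: the sum of `π - β` over the interior vertices, `β` being the angle there. -/
noncomputable def totalRotation : ℝ :=
  ∑ i ∈ Finset.range (σ.n - 1), (Real.pi - σ.vertexAngle i)

/-- All the arcs of `γ` cut off by the segments of the polygon have diameter less than `δ`. -/
def MeshLT (δ : ℝ) : Prop :=
  ∀ i < σ.n, Metric.diam (γ '' Icc (σ.t i) (σ.t (i + 1))) < δ

end InscribedPolygon

/-- Total curvature of `γ` restricted to `[a, b]`: the limit superior of the total rotation of the
inscribed polygonal curves as their mesh tends to `0`. -/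
noncomputable def totalCurvature (γ : ℝ → X) (a b : ℝ) : ℝ≥0∞ :=
  ⨅ (δ : ℝ) (_ : 0 < δ), ⨆ (σ : InscribedPolygon γ a b) (_ : σ.MeshLT δ),
    ENNReal.ofReal σ.totalRotation

end Metric

end CatOne

/-! Sublinear total curvature forces long windows of `γ` with little rotation. Take a fine inscribed
polygon, almost as long as `γ` on `[0, N * L]`, with total rotation small compared to `N`. By
pigeonhole, one of the `N` windows of length `L` carries rotation at most a prescribed `κ`
(`exists_window_rotation_lt`).

Small rotation makes short arcs nearly straight. Distance from a point is convex along short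
geodesics, and at a vertex of angle `β` its slope drops by at most `2 * (π - β)` (`slope_le`).
Measured from the initial vertex of an arc, the slope starts at `1`, so it stays above `1 - 2 * κ`,
and the chord is at least `1 - 2 * κ` times the polygonal length (`mul_sum_le_dist`). Hence `γ`
almost realizes distances over lengths up to `1 / 2` throughout the window
(`exists_almost_geodesic_arc`).

Recentring ever longer and straighter windows at `0`, compactness gives a limit `ρ`. It is
1-Lipschitz and preserves distances up to `1 / 2`, hence is a local geodesic. The Lipschitz bound
makes convergence on compact intervals uniform. -/

namespace CatOne

/-! ### Model triangles in the unit sphere -/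

/-- The point of the unit sphere with given coordinates. -/
noncomputable def spherePoint (x y z : ℝ) (h : x ^ 2 + y ^ 2 + z ^ 2 = 1) : UnitSphere :=
  ⟨!₂[x, y, z], by simp [EuclideanSpace.norm_eq, Fin.sum_univ_three, h]⟩

theorem sphereDist_spherePoint {x y z x' y' z' : ℝ} (h : x ^ 2 + y ^ 2 + z ^ 2 = 1)
    (h' : x' ^ 2 + y' ^ 2 + z' ^ 2 = 1) :
    sphereDist (spherePoint x y z h) (spherePoint x' y' z' h') =
      Real.arccos (x * x' + y * y' + z * z') := by
  have n1 := norm_eq_of_mem_sphere (spherePoint x y z h)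
  have n2 := norm_eq_of_mem_sphere (spherePoint x' y' z' h')
  rw [sphereDist, InnerProductGeometry.angle, n1, n2]
  simp [spherePoint, PiLp.inner_apply, Fin.sum_univ_three, mul_comm]

/-- Half-angle coordinates of the apex of a spherical triangle satisfy `x ^ 2 + y ^ 2 ≤ 1`. -/
theorem apex_sq_add_sq_le {a b l : ℝ} (hl : 0 < l) (hlπ : l < Real.pi) (hab : |a - b| ≤ l)
    (hla : l ≤ a + b) (hp : a + b + l < 2 * Real.pi) :
    ((Real.cos a + Real.cos b) / (2 * Real.cos (l / 2))) ^ 2 +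
      ((Real.cos b - Real.cos a) / (2 * Real.sin (l / 2))) ^ 2 ≤ 1 := by
  have hc : 0 < Real.cos (l / 2) := Real.cos_pos_of_mem_Ioo ⟨by linarith, by linarith⟩
  have hs : 0 < Real.sin (l / 2) := Real.sin_pos_of_pos_of_lt_pi (by linarith) (by linarith)
  have e1 := Real.cos_add_cos a b
  have e2 := Real.cos_sub_cos b a
  have hQ : Real.cos (l / 2) ≤ Real.cos ((a - b) / 2) := by
    rw [← Real.cos_abs ((a - b) / 2)]
    apply Real.cos_le_cos_of_nonneg_of_le_pi (abs_nonneg _) (by linarith)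
    rw [abs_div, abs_two]; linarith
  have hP1 : Real.cos ((a + b) / 2) ≤ Real.cos (l / 2) :=
    Real.cos_le_cos_of_nonneg_of_le_pi (by linarith) (by linarith) (by linarith)
  have hP2 : -Real.cos (l / 2) ≤ Real.cos ((a + b) / 2) := by
    rw [← Real.cos_pi_sub]
    exact Real.cos_le_cos_of_nonneg_of_le_pi (by linarith) (by linarith) (by linarith)
  have s1 := Real.sin_sq_add_cos_sq ((a + b) / 2)
  have s2 := Real.sin_sq_add_cos_sq ((a - b) / 2)
  have s3 := Real.sin_sq_add_cos_sq (l / 2)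
  have e2' : Real.cos b - Real.cos a = 2 * Real.sin ((a + b) / 2) * Real.sin ((a - b) / 2) := by
    rw [e2, add_comm b a, show (b - a) / 2 = -((a - b) / 2) by ring, Real.sin_neg]; ring
  rw [e1, e2']
  generalize Real.cos ((a + b) / 2) = P at *
  generalize Real.cos ((a - b) / 2) = Q at *
  generalize Real.cos (l / 2) = C at *
  generalize Real.sin ((a + b) / 2) = P' at *
  generalize Real.sin ((a - b) / 2) = Q' at *
  generalize Real.sin (l / 2) = C' at *
  -- After clearing denominators the claim is `(C ^ 2 - P ^ 2) * (Q ^ 2 - C ^ 2) ≥ 0`.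
  have hP : P ^ 2 ≤ C ^ 2 := sq_le_sq' hP2 hP1
  have hQ2 : C ^ 2 ≤ Q ^ 2 := by nlinarith
  have h1 : (2 * P * Q / (2 * C)) ^ 2 = P ^ 2 * Q ^ 2 / C ^ 2 := by field_simp
  have h2 : (2 * P' * Q' / (2 * C')) ^ 2 = P' ^ 2 * Q' ^ 2 / C' ^ 2 := by field_simp
  rw [h1, h2, div_add_div _ _ (by positivity) (by positivity), div_le_one (by positivity)]
  have t1 : P' ^ 2 = 1 - P ^ 2 := by linarith
  have t2 : Q' ^ 2 = 1 - Q ^ 2 := by linarith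
  have t3 : C' ^ 2 = 1 - C ^ 2 := by linarith
  rw [t1, t2, t3]
  nlinarith [mul_nonneg (sub_nonneg.2 hP) (sub_nonneg.2 hQ2)]

/-- A spherical triangle with given side lengths, together with the midpoint of one side. -/
theorem exists_model_triangle {a b l : ℝ} (ha : 0 ≤ a) (hb : 0 ≤ b) (hl : 0 < l)
    (hab : |a - b| ≤ l) (hla : l ≤ a + b) (hp : a + b + l < 2 * Real.pi) :
    ∃ p q r m : UnitSphere, sphereDist q p = a ∧ sphereDist p q = a ∧ sphereDist r p = b ∧
      sphereDist q r = l ∧ sphereDist p p = 0 ∧ sphereDist q m = l / 2 ∧ sphereDist m r = l / 2 ∧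
      2 * Real.cos (l / 2) * Real.cos (sphereDist m p) = Real.cos a + Real.cos b := by
  obtain ⟨hab1, hab2⟩ := abs_le.1 hab
  have hlπ : l < Real.pi := by linarith
  have hc : 0 < Real.cos (l / 2) := Real.cos_pos_of_mem_Ioo ⟨by linarith, by linarith⟩
  have hs : 0 < Real.sin (l / 2) := Real.sin_pos_of_pos_of_lt_pi (by linarith) (by linarith)
  have hle := apex_sq_add_sq_le hl hlπ hab hla hp
  set x := (Real.cos a + Real.cos b) / (2 * Real.cos (l / 2)) with hx
  set y := (Real.cos b - Real.cos a) / (2 * Real.sin (l / 2)) with hy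
  have s3 := Real.sin_sq_add_cos_sq (l / 2)
  have hz : x ^ 2 + y ^ 2 + Real.sqrt (1 - x ^ 2 - y ^ 2) ^ 2 = 1 := by
    rw [Real.sq_sqrt (by linarith)]; ring
  have hxe : x * (2 * Real.cos (l / 2)) = Real.cos a + Real.cos b := by rw [hx]; field_simp
  have hye : y * (2 * Real.sin (l / 2)) = Real.cos b - Real.cos a := by rw [hy]; field_simp
  have hcl : Real.cos l = Real.cos (l / 2) ^ 2 - Real.sin (l / 2) ^ 2 := by
    rw [← Real.cos_two_mul']; congr 1; ring
  -- The base lies on the equator, symmetric about its midpoint `(1, 0, 0)`; `x` and `y` solve the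
  -- linear equations prescribing the cosines of the other two sides.
  refine ⟨spherePoint x y _ hz, spherePoint (Real.cos (l / 2)) (-Real.sin (l / 2)) 0 (by nlinarith),
    spherePoint (Real.cos (l / 2)) (Real.sin (l / 2)) 0 (by nlinarith),
    spherePoint 1 0 0 (by norm_num), ?_⟩
  have ea : Real.arccos (Real.cos a) = a := Real.arccos_cos ha (by linarith)
  have eb : Real.arccos (Real.cos b) = b := Real.arccos_cos hb (by linarith)
  have el : Real.arccos (Real.cos l) = l := Real.arccos_cos hl.le hlπ.le
  have el2 : Real.arccos (Real.cos (l / 2)) = l / 2 :=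
    Real.arccos_cos (by linarith) (by linarith)
  simp only [sphereDist_spherePoint]
  refine ⟨?_, ?_, ?_, ?_, ?_, ?_, ?_, ?_⟩
  · refine Eq.trans ?_ ea; congr 1; linarith
  · refine Eq.trans ?_ ea; congr 1; linarith
  · refine Eq.trans ?_ eb; congr 1; linarith
  · refine Eq.trans ?_ el; congr 1; linarith
  · rw [← Real.arccos_one]; congr 1; linarith
  · refine Eq.trans ?_ el2; congr 1; ring
  · refine Eq.trans ?_ el2; congr 1; ring
  · rw [Real.cos_arccos (by nlinarith) (by nlinarith)]; linarith

/-! ### Convexity of the distance along short geodesics -/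

variable {X : Type*} [MetricSpace X]

namespace IsGeodesicSegment

theorem sub_segment {c : ℝ → X} {l : ℝ} {p q : X} (hc : IsGeodesicSegment c l p q) {u v : ℝ}
    (hu : 0 ≤ u) (huv : u ≤ v) (hv : v ≤ l) :
    IsGeodesicSegment (fun s => c (u + s)) (v - u) (c u) (c v) where
  nonneg := sub_nonneg.2 huv
  source := by simp
  target := by simp
  dist_eq s hs t ht := by
    rw [hc.dist_eq _ ⟨by linarith [hs.1], by linarith [hs.2]⟩ _
      ⟨by linarith [ht.1], by linarith [ht.2]⟩]
    congr 1; ring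

theorem dist_eq_sub {c : ℝ → X} {l : ℝ} {p q : X} (hc : IsGeodesicSegment c l p q) {u v : ℝ}
    (hu : 0 ≤ u) (huv : u ≤ v) (hv : v ≤ l) : dist (c u) (c v) = v - u := by
  rw [hc.dist_eq _ ⟨hu, huv.trans hv⟩ _ ⟨hu.trans huv, hv⟩, abs_sub_comm,
    abs_of_nonneg (sub_nonneg.2 huv)]

theorem length_eq {c : ℝ → X} {l : ℝ} {p q : X} (hc : IsGeodesicSegment c l p q) :
    dist p q = l := by
  rw [← hc.source, ← hc.target, hc.dist_eq_sub le_rfl hc.nonneg le_rfl, sub_zero]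

end IsGeodesicSegment

/-- Comparison of the distance from a vertex to the midpoint of the opposite side. -/
theorem IsCAT1.cos_add_cos_le (hX : IsCAT1 X) {p q r : X} {c : ℝ → X} {l : ℝ}
    (hc : IsGeodesicSegment c l q r) (hl : 0 < l)
    (hp : dist p q + dist p r + l < 2 * Real.pi) :
    Real.cos (dist p q) + Real.cos (dist p r) ≤
      2 * Real.cos (l / 2) * Real.cos (dist p (c (l / 2))) := by
  have hlen := hc.length_eq
  have t1 := dist_triangle p q r
  have t2 := dist_triangle p r q
  have t3 := dist_triangle q p r
  rw [dist_comm r q] at t2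
  rw [dist_comm q p] at t3
  obtain ⟨p', q', r', m', h1, h2, h4, h5, h7, h8, h9, h10⟩ :=
    exists_model_triangle (a := dist p q) (b := dist p r) (l := l) dist_nonneg dist_nonneg hl
      (abs_le.2 ⟨by linarith, by linarith⟩) (by linarith) hp
  obtain ⟨c', hc'⟩ := hX.exists_geodesic q p (by rw [dist_comm]; linarith)
  have hcomp := hX.comparison q r p c c' (by
      rw [hlen, dist_comm r p, add_right_comm]; linarith [dist_comm p q])
    (by rwa [hlen]) hc' q' r' p' (by rw [h5, hlen]) (by rw [h4, dist_comm]) h2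
    (l / 2) ⟨by linarith, by linarith⟩ (dist q p) ⟨dist_nonneg, le_rfl⟩ m' p' h8
    (by rw [h9, hlen]; ring) (by rw [h1, dist_comm]) (by rw [h7, sub_self])
  rw [hc'.target, dist_comm] at hcomp
  rw [← h10]
  have hc : 0 < Real.cos (l / 2) := Real.cos_pos_of_mem_Ioo ⟨by linarith, by linarith⟩
  gcongr
  exact Real.cos_le_cos_of_nonneg_of_le_pi dist_nonneg (InnerProductGeometry.angle_le_pi _ _) hcomp

/-- The distance from a point is midpoint convex along short geodesics. -/
theorem IsCAT1.dist_midpoint_le (hX : IsCAT1 X) {o q r : X} {c : ℝ → X} {l : ℝ}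
    (hc : IsGeodesicSegment c l q r) (hl1 : l ≤ 1) (hq : dist o q ≤ 3 / 2)
    (hr : dist o r ≤ 3 / 2) : dist o (c (l / 2)) ≤ (dist o q + dist o r) / 2 := by
  have hπ := Real.pi_gt_three
  rcases hc.nonneg.eq_or_lt with h0 | hl
  · subst h0
    have := hc.source
    have := hc.target
    simp_all
  have hlen := hc.length_eq
  have h := hX.cos_add_cos_le (p := o) hc hl (by linarith)
  have hm : dist q (c (l / 2)) = l / 2 := by
    have := hc.dist_eq_sub le_rfl (by linarith : 0 ≤ l / 2) (by linarith)
    rwa [hc.source, sub_zero] at this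
  have t1 := dist_triangle o q (c (l / 2))
  have t2 := dist_triangle o q r
  have t3 := dist_triangle o r q
  rw [dist_comm r q] at t3
  have a0 : 0 ≤ dist o q := dist_nonneg
  have b0 : 0 ≤ dist o r := dist_nonneg
  have hc2 : 0 < Real.cos (l / 2) := Real.cos_pos_of_mem_Ioo ⟨by linarith, by linarith⟩
  have hP : 0 ≤ Real.cos ((dist o q + dist o r) / 2) :=
    Real.cos_nonneg_of_mem_Icc ⟨by linarith, by linarith⟩
  have hQ : Real.cos (l / 2) ≤ Real.cos ((dist o q - dist o r) / 2) := by
    rw [← Real.cos_abs ((dist o q - dist o r) / 2)]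
    apply Real.cos_le_cos_of_nonneg_of_le_pi (abs_nonneg _) (by linarith)
    rw [abs_le]; constructor <;> linarith
  rw [Real.cos_add_cos] at h
  -- The sum of cosines is now a product whose second factor is at least `cos (l / 2)` by the
  -- triangle inequality, so `cos (l / 2)` cancels.
  have key : Real.cos ((dist o q + dist o r) / 2) ≤ Real.cos (dist o (c (l / 2))) := by
    have := mul_le_mul_of_nonneg_left hQ hP
    by_contra! hlt
    have := mul_lt_mul_of_pos_left hlt hc2
    nlinarith
  by_contra! hlt
  exact absurd key (not_le.2 (Real.cos_lt_cos_of_nonneg_of_le_pi (by linarith) (by linarith) hlt))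

/-- The distance from a point is convex along short geodesics. -/
theorem IsCAT1.dist_le_affine (hX : IsCAT1 X) {o q r : X} {c : ℝ → X} {l : ℝ}
    (hc : IsGeodesicSegment c l q r) (hl : 0 < l) (hl1 : l ≤ 1 / 2) (hq : dist o q ≤ 1)
    {s : ℝ} (hs : s ∈ Icc 0 l) :
    dist o (c s) ≤ dist o q + s / l * (dist o r - dist o q) := by
  have hcont : ContinuousOn c (Icc 0 l) :=
    (LipschitzOnWith.of_dist_le_mul (K := 1) fun x hx y hy => by
      rw [hc.dist_eq x hx y hy, NNReal.coe_one, one_mul, Real.dist_eq]).continuousOn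
  -- `g` vanishes at both ends. Reflecting the nearer end in a maximum point `m`, midpoint convexity
  -- gives `g m ≤ g m / 2`.
  set g : ℝ → ℝ := fun s => dist o (c s) - (dist o q + s / l * (dist o r - dist o q)) with hg
  have hgc : ContinuousOn g (Icc 0 l) := by
    exact ((continuous_const.dist continuous_id).comp_continuousOn hcont).sub (by fun_prop)
  obtain ⟨m, hm, hmax⟩ := isCompact_Icc.exists_isMaxOn ⟨s, hs⟩ hgc
  have hmid : ∀ u v, 0 ≤ u → u ≤ v → v ≤ l → g ((u + v) / 2) ≤ (g u + g v) / 2 := by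
    intro u v hu huv hv
    have hb : ∀ w, 0 ≤ w → w ≤ l → dist o (c w) ≤ 3 / 2 := fun w h0 hw => by
      have h1 := hc.dist_eq_sub le_rfl h0 hw
      rw [hc.source] at h1
      linarith [dist_triangle o q (c w)]
    have := hX.dist_midpoint_le (hc.sub_segment hu huv hv) (by linarith)
      (hb u hu (huv.trans hv)) (hb v (hu.trans huv) hv)
    rw [show u + (v - u) / 2 = (u + v) / 2 by ring] at this
    simp only [hg]
    have e : (u + v) / 2 / l = (u / l + v / l) / 2 := by ring
    rw [e]; linarith
  have g0 : g 0 = 0 := by simp [hg, hc.source]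
  have gl : g l = 0 := by simp [hg, hc.target, hl.ne']
  have hM : g m ≤ 0 := by
    rcases le_total m (l / 2) with h | h
    · have h1 := hmid 0 (2 * m) le_rfl (by linarith [hm.1]) (by linarith)
      have h2 : g (2 * m) ≤ g m := hmax ⟨by linarith [hm.1], by linarith⟩
      rw [show (0 + 2 * m) / 2 = m by ring] at h1
      linarith
    · have h1 := hmid (2 * m - l) l (by linarith) (by linarith [hm.2]) le_rfl
      have h2 : g (2 * m - l) ≤ g m := hmax ⟨by linarith, by linarith [hm.2]⟩
      rw [show (2 * m - l + l) / 2 = m by ring] at h1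
      linarith
  have : g s ≤ g m := hmax hs
  simp only [hg] at this hM
  linarith

/-! ### Angles and the loss of slope at a vertex -/

theorem geodesicAngle_le {c c' : ℝ → X} {l l' s s' : ℝ} (hs : s ∈ Ioc 0 l) (hs' : s' ∈ Ioc 0 l')
    (h : s + s' + dist (c s) (c' s') < 2 * Real.pi) :
    geodesicAngle c l c' l' ≤ modelAngle s s' (dist (c s) (c' s')) :=
  csInf_le ⟨0, by rintro _ ⟨_, _, _, _, _, rfl⟩; exact Real.arccos_nonneg _⟩ ⟨s, hs, s', hs', h, rfl⟩

theorem geodesicAngle_le_pi (c : ℝ → X) (l : ℝ) (c' : ℝ → X) (l' : ℝ) :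
    geodesicAngle c l c' l' ≤ Real.pi := by
  unfold geodesicAngle
  rcases Set.eq_empty_or_nonempty {θ : ℝ | ∃ s ∈ Ioc 0 l, ∃ s' ∈ Ioc 0 l',
    s + s' + dist (c s) (c' s') < 2 * Real.pi ∧ θ = modelAngle s s' (dist (c s) (c' s'))} with h | h
  · rw [h, Real.sInf_empty]; exact Real.pi_pos.le
  · obtain ⟨θ, hθ⟩ := h
    refine (csInf_le ⟨0, ?_⟩ hθ).trans ?_
    · rintro _ ⟨_, _, _, _, _, rfl⟩; exact Real.arccos_nonneg _
    · obtain ⟨_, _, _, _, _, rfl⟩ := hθ; exact Real.arccos_le_pi _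

/-- In an isosceles model triangle with legs `s` and base `d`, the height is at most
`s * (π - modelAngle s s d)`. -/
theorem height_le {s d e : ℝ} (hs : 0 < s) (hs2 : s ≤ 1 / 2) (hd : 0 ≤ d) (hds : d ≤ 2 * s)
    (he0 : 0 ≤ e) (he : e ≤ 1) (h : Real.cos s ≤ Real.cos (d / 2) * Real.cos e) :
    e ≤ s * (Real.pi - modelAngle s s d) := by
  have hπ := Real.pi_gt_three
  have hss : 0 < Real.sin s := Real.sin_pos_of_pos_of_lt_pi hs (by linarith)
  have hcs : 1 / 2 ≤ Real.cos s := by nlinarith [Real.one_sub_sq_div_two_le_cos (x := s)]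
  have hce : 0 < Real.cos e := Real.cos_pos_of_mem_Ioo ⟨by linarith, by linarith⟩
  have hcd : 0 < Real.cos (d / 2) := Real.cos_pos_of_mem_Ioo ⟨by linarith, by linarith⟩
  have hsd0 : 0 ≤ Real.sin (d / 2) := Real.sin_nonneg_of_nonneg_of_le_pi (by linarith) (by linarith)
  have hsd : Real.sin (d / 2) ≤ Real.sin s :=
    Real.sin_le_sin_of_le_of_le_pi_div_two (by linarith) (by linarith) (by linarith)
  have p1 := Real.sin_sq_add_cos_sq s
  have p2 := Real.sin_sq_add_cos_sq (d / 2)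
  have p3 := Real.sin_sq_add_cos_sq e
  have hd2 : Real.cos d = 1 - 2 * Real.sin (d / 2) ^ 2 := by
    have := Real.cos_sq (d / 2)
    rw [mul_div_cancel₀ d two_ne_zero] at this
    linarith
  set A := modelAngle s s d with hA
  have hA0 : 0 ≤ A := Real.arccos_nonneg _
  have hAπ : A ≤ Real.pi := Real.arccos_le_pi _
  have hcosA : Real.cos A = 1 - 2 * (Real.sin (d / 2) ^ 2 / Real.sin s ^ 2) := by
    have e1 : (Real.cos d - Real.cos s * Real.cos s) / (Real.sin s * Real.sin s) =
        1 - 2 * (Real.sin (d / 2) ^ 2 / Real.sin s ^ 2) := by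
      field_simp; linarith
    have e2 : Real.sin (d / 2) ^ 2 / Real.sin s ^ 2 ≤ 1 := by
      rw [div_le_one (by positivity)]; gcongr
    have e3 : 0 ≤ Real.sin (d / 2) ^ 2 / Real.sin s ^ 2 := by positivity
    rw [hA, modelAngle, e1, Real.cos_arccos (by linarith) (by linarith)]
  have hk : 0 ≤ Real.cos (A / 2) := Real.cos_nonneg_of_mem_Icc ⟨by linarith, by linarith⟩
  have hk2 : Real.cos (A / 2) ^ 2 * Real.sin s ^ 2 = Real.sin s ^ 2 - Real.sin (d / 2) ^ 2 := by
    rw [Real.cos_sq, mul_div_cancel₀ A two_ne_zero, hcosA]; field_simp; ring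
  have hkle : Real.cos (A / 2) ≤ (Real.pi - A) / 2 := by
    rw [← Real.sin_pi_div_two_sub, show Real.pi / 2 - A / 2 = (Real.pi - A) / 2 by ring]
    exact Real.sin_le (by linarith)
  -- Spherical Pythagoras in half of the isosceles triangle; the factor `2` absorbs `1 / cos s`.
  have htan : Real.tan e ≤ 2 * Real.sin s * Real.cos (A / 2) := by
    have hse : 0 ≤ Real.sin e := Real.sin_nonneg_of_nonneg_of_le_pi he0 (by linarith)
    rw [Real.tan_eq_sin_div_cos, div_le_iff₀ hce]
    apply abs_le_of_sq_le_sq' _ (by positivity) |>.2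
    have h2 : Real.cos s ^ 2 ≤ Real.cos (d / 2) ^ 2 * Real.cos e ^ 2 := by
      rw [← mul_pow]; gcongr
    have h3 : (2 * Real.sin s * Real.cos (A / 2) * Real.cos e) ^ 2 =
        4 * (Real.sin s ^ 2 - Real.sin (d / 2) ^ 2) * Real.cos e ^ 2 := by rw [← hk2]; ring
    rw [h3]
    have h4 : Real.sin s ^ 2 - Real.sin (d / 2) ^ 2 = Real.cos (d / 2) ^ 2 - Real.cos s ^ 2 := by
      linarith
    rw [h4]
    have h5 : 1 / 4 ≤ Real.cos s ^ 2 := by nlinarith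
    have h7 : 0 ≤ Real.cos (d / 2) ^ 2 - Real.cos s ^ 2 := by
      rw [← h4]; exact sub_nonneg.2 (by gcongr)
    have h8 : Real.cos s ^ 2 * Real.sin e ^ 2 ≤
        (Real.cos (d / 2) ^ 2 - Real.cos s ^ 2) * Real.cos e ^ 2 := by
      rw [show Real.sin e ^ 2 = 1 - Real.cos e ^ 2 by linarith]; linarith
    have h9 := mul_le_mul_of_nonneg_right h5 (sq_nonneg (Real.sin e))
    linarith
  calc e ≤ Real.tan e := Real.le_tan he0 (by linarith)
    _ ≤ 2 * Real.sin s * Real.cos (A / 2) := htan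
    _ ≤ 2 * s * ((Real.pi - A) / 2) := by gcongr; exact Real.sin_le hs.le
    _ = s * (Real.pi - A) := by ring

/-- At a vertex of angle `β` between two short geodesics, the slope of the distance from a point
drops by at most `2 * (π - β)`. -/
theorem IsCAT1.slope_le (hX : IsCAT1 X) {o p q r : X} {c c' : ℝ → X} {l l' : ℝ}
    (hc : IsGeodesicSegment c l p q) (hc' : IsGeodesicSegment c' l' q r) (hl : 0 < l)
    (hl' : 0 < l') (hl2 : l ≤ 1 / 2) (hl2' : l' ≤ 1 / 2) (hp : dist o p ≤ 1 / 2)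
    (hq : dist o q ≤ 1 / 2) :
    (dist o q - dist o p) / l - 2 * (Real.pi - geodesicAngle (fun s => c (l - s)) l c' l') ≤
      (dist o r - dist o q) / l' := by
  have hπ := Real.pi_gt_three
  set β := geodesicAngle (fun s => c (l - s)) l c' l' with hβ
  -- Equal legs `s` are cut off at `q`, ending at `x` and `y`. The midpoint `m` of `x` and `y` is
  -- within `s * (π - β)` of `q`, and `dist o m` is at most the mean of `dist o x` and `dist o y`;
  -- convexity on each side bounds these two. Undoing the mean produces the factor `2`.
  obtain ⟨s, hs0, hs1, hs2⟩ : ∃ s, 0 < s ∧ s ≤ l ∧ s ≤ l' :=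
    ⟨min l l', lt_min hl hl', min_le_left _ _, min_le_right _ _⟩
  have dx : dist (c (l - s)) q = s := by
    have := hc.dist_eq_sub (by linarith : 0 ≤ l - s) (by linarith) le_rfl
    rw [hc.target] at this; linarith
  have dy : dist q (c' s) = s := by
    have := hc'.dist_eq_sub le_rfl hs0.le hs2
    rw [hc'.source] at this; linarith
  have hx := hX.dist_le_affine (o := o) hc hl hl2 (by linarith) (s := l - s)
    ⟨by linarith, by linarith⟩
  have hy := hX.dist_le_affine (o := o) hc' hl' hl2' (by linarith) (s := s) ⟨hs0.le, hs2⟩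
  set x := c (l - s) with hxdef
  set y := c' s with hydef
  have dxy := dist_triangle x q y
  have tx := dist_triangle o q x
  have ty := dist_triangle o q y
  rw [dist_comm q x] at tx
  have hang : β ≤ modelAngle s s (dist x y) :=
    geodesicAngle_le (c := fun s => c (l - s)) ⟨hs0, hs1⟩ ⟨hs0, hs2⟩ (by linarith)
  obtain ⟨g, hg⟩ := hX.exists_geodesic x y (by linarith)
  set m := g (dist x y / 2) with hm
  have hmid : dist o m ≤ (dist o x + dist o y) / 2 :=
    hX.dist_midpoint_le hg (by linarith) (by linarith) (by linarith)
  have hh : dist q m ≤ s * (Real.pi - modelAngle s s (dist x y)) := by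
    have d0 : 0 ≤ dist x y := dist_nonneg
    have dxm : dist x m = dist x y / 2 := by
      have := hg.dist_eq_sub le_rfl (by linarith : 0 ≤ dist x y / 2) (by linarith)
      rw [hg.source] at this; linarith
    have tm := dist_triangle q x m
    rw [dist_comm q x] at tm
    apply height_le hs0 (by linarith) d0 (by linarith) dist_nonneg (by linarith)
    rcases d0.eq_or_lt with h0 | h0
    · have : x = m := by rw [← dist_eq_zero]; linarith
      rw [← this, dist_comm q x, dx, ← h0]; simp
    · have := hX.cos_add_cos_le (p := q) hg h0 (by rw [dist_comm q x]; linarith)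
      rw [dist_comm q x, dx, dy] at this
      linarith
  have tq := dist_triangle o m q
  rw [dist_comm m q] at tq
  have e1 : (l - s) / l = 1 - s / l := by field_simp
  rw [e1] at hx
  have hbs : s * (Real.pi - modelAngle s s (dist x y)) ≤ s * (Real.pi - β) := by gcongr
  have key : s * ((dist o q - dist o p) / l - 2 * (Real.pi - β)) ≤
      s * ((dist o r - dist o q) / l') := by
    have e2 : s * ((dist o q - dist o p) / l) = s / l * (dist o q - dist o p) := by ring
    have e3 : s * ((dist o r - dist o q) / l') = s / l' * (dist o r - dist o q) := by ring
    rw [mul_sub, e2, e3]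
    linarith
  exact le_of_mul_le_mul_left key hs0

/-! ### Chord and length of polygonal arcs -/

namespace InscribedPolygon

variable {γ : ℝ → X} {a b : ℝ} (σ : InscribedPolygon γ a b)

theorem segLength_pos {i : ℕ} (hi : i < σ.n) : 0 < σ.segLength i := dist_pos.2 (σ.ne_succ i hi)

theorem rotation_nonneg (i : ℕ) : 0 ≤ Real.pi - σ.vertexAngle i :=
  sub_nonneg.2 (geodesicAngle_le_pi _ _ _ _)

theorem dist_le_sum {i j : ℕ} (hij : i ≤ j) :
    dist (γ (σ.t i)) (γ (σ.t j)) ≤ ∑ k ∈ Finset.Ico i j, σ.segLength k :=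
  dist_le_Ico_sum_dist (fun k => γ (σ.t k)) hij

/-- Along the first segment the slope is exactly `1`, and each later vertex costs twice its rotation
by `slope_le`. The length bound keeps all vertices within the range of that lemma. -/
theorem slope_ge (hX : IsCAT1 X) {i : ℕ} (d : ℕ) (hd : i + d < σ.n)
    (hlen : ∑ k ∈ Finset.Ico i (i + d + 1), σ.segLength k ≤ 1 / 2) :
    1 - 2 * ∑ k ∈ Finset.Ico i (i + d), (Real.pi - σ.vertexAngle k) ≤
      (dist (γ (σ.t i)) (γ (σ.t (i + d + 1))) - dist (γ (σ.t i)) (γ (σ.t (i + d)))) /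
        σ.segLength (i + d) := by
  induction d with
  | zero =>
    have := σ.segLength_pos hd
    simp only [add_zero, Finset.Ico_self, Finset.sum_empty, mul_zero, sub_zero, dist_self] at this ⊢
    rw [show dist (γ (σ.t i)) (γ (σ.t (i + 1))) = σ.segLength i from rfl, div_self this.ne']
  | succ d ih =>
    have hnn : ∀ k, 0 ≤ σ.segLength k := fun _ => dist_nonneg
    have hsub : ∀ s ⊆ Finset.Ico i (i + (d + 1) + 1), ∑ k ∈ s, σ.segLength k ≤ 1 / 2 := fun s hs =>
      (Finset.sum_le_sum_of_subset_of_nonneg hs fun k _ _ => hnn k).trans hlen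
    have ih' := ih (by omega) (hsub _ (Finset.Ico_subset_Ico_right (by omega)))
    have one : ∀ k, i ≤ k → k < i + (d + 1) + 1 → σ.segLength k ≤ 1 / 2 := fun k h1 h2 => by
      simpa using hsub {k} (by simpa using ⟨h1, by omega⟩)
    have key := hX.slope_le (o := γ (σ.t i)) (σ.isGeodesic (i + d) (by omega))
      (σ.isGeodesic (i + d + 1) (by omega)) (σ.segLength_pos (by omega))
      (σ.segLength_pos (i := i + d + 1) (by omega)) (one _ (by omega) (by omega))
      (one (i + d + 1) (by omega) (by omega))
      ((σ.dist_le_sum (by omega)).trans (hsub _ (Finset.Ico_subset_Ico_right (by omega))))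
      ((σ.dist_le_sum (by omega)).trans (hsub _ (Finset.Ico_subset_Ico_right (by omega))))
    change _ - 2 * (Real.pi - σ.vertexAngle (i + d)) ≤ _ at key
    rw [← add_assoc, Finset.sum_Ico_succ_top (by omega)]
    refine le_trans ?_ key
    change _ ≤ _ / σ.segLength (i + d) - _
    linarith

/-- A short polygonal arc of small rotation is almost as short as its chord. -/
theorem mul_sum_le_dist (hX : IsCAT1 X) {i j : ℕ} (hij : i ≤ j) (hj : j ≤ σ.n) {κ : ℝ}
    (hlen : ∑ k ∈ Finset.Ico i j, σ.segLength k ≤ 1 / 2)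
    (hκ : ∑ k ∈ Finset.Ico i (j - 1), (Real.pi - σ.vertexAngle k) ≤ κ) :
    (1 - 2 * κ) * ∑ k ∈ Finset.Ico i j, σ.segLength k ≤ dist (γ (σ.t i)) (γ (σ.t j)) := by
  induction j, hij using Nat.le_induction with
  | base => simp
  | succ j hij ih =>
    have hmono : ∑ k ∈ Finset.Ico i (j - 1), (Real.pi - σ.vertexAngle k) ≤
        ∑ k ∈ Finset.Ico i j, (Real.pi - σ.vertexAngle k) :=
      Finset.sum_le_sum_of_subset_of_nonneg (Finset.Ico_subset_Ico_right (by omega))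
        fun k _ _ => σ.rotation_nonneg k
    -- `vertexAngle k` sits at vertex `k + 1`, so the interior vertices of the arc from `i` to `j +
    -- 1` have indices in `Ico i j`.
    rw [Nat.add_sub_cancel] at hκ
    obtain ⟨d, rfl⟩ := Nat.exists_eq_add_of_le hij
    have h := σ.slope_ge hX d (by omega) hlen
    have hpos := σ.segLength_pos (i := i + d) (by omega)
    rw [le_div_iff₀ hpos] at h
    rw [Finset.sum_Ico_succ_top hij] at hlen ⊢
    have := ih (by omega) (by linarith) (by linarith)
    nlinarith

end InscribedPolygon

/-! ### Unit speed curves and fine inscribed polygons -/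

section UnitSpeed

variable {γ : ℝ → X} (hγ : HasUnitSpeedOn γ (Ici 0))
include hγ

theorem eVariationOn_Icc_of_hasUnitSpeedOn {s t : ℝ} (hs : 0 ≤ s) (hst : s ≤ t) :
    eVariationOn γ (Icc s t) = ENNReal.ofReal (t - s) := by
  have h := hγ (mem_Ici.2 hs) (mem_Ici.2 (hs.trans hst))
  rwa [inter_eq_right.2 (fun x hx => mem_Ici.2 (hs.trans hx.1)), NNReal.coe_one, one_mul] at h

theorem dist_le_sub_of_hasUnitSpeedOn {s t : ℝ} (hs : 0 ≤ s) (hst : s ≤ t) :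
    dist (γ s) (γ t) ≤ t - s := by
  have h := eVariationOn.edist_le γ (left_mem_Icc.2 hst) (right_mem_Icc.2 hst)
  rw [eVariationOn_Icc_of_hasUnitSpeedOn hγ hs hst, edist_dist] at h
  exact (ENNReal.ofReal_le_ofReal_iff (sub_nonneg.2 hst)).1 h

theorem dist_le_abs_of_hasUnitSpeedOn {s t : ℝ} (hs : 0 ≤ s) (ht : 0 ≤ t) :
    dist (γ s) (γ t) ≤ |s - t| := by
  rcases le_total s t with h | h
  · rw [abs_sub_comm]
    exact (dist_le_sub_of_hasUnitSpeedOn hγ hs h).trans (le_abs_self _)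
  · rw [dist_comm]
    exact (dist_le_sub_of_hasUnitSpeedOn hγ ht h).trans (le_abs_self _)

theorem continuousOn_of_hasUnitSpeedOn : ContinuousOn γ (Ici 0) :=
  (LipschitzOnWith.of_dist_le_mul (K := 1) fun x hx y hy => by
    rw [NNReal.coe_one, one_mul, Real.dist_eq]
    exact dist_le_abs_of_hasUnitSpeedOn hγ hx hy).continuousOn

/-- Otherwise the connected image lies in a two-point set, so it is a single point and the arc has
length zero. -/
theorem exists_ne_ne_of_hasUnitSpeedOn {a b : ℝ} (ha : 0 ≤ a) (hab : a < b) (p q : X) :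
    ∃ x ∈ Icc a b, γ x ≠ p ∧ γ x ≠ q := by
  by_contra! h
  have hsub : γ '' Icc a b ⊆ {p, q} := by
    rintro _ ⟨x, hx, rfl⟩
    by_cases hp : γ x = p
    · exact Or.inl hp
    · exact Or.inr (h x hx hp)
  have hconn : IsPreconnected (γ '' Icc a b) := isPreconnected_Icc.image _
    ((continuousOn_of_hasUnitSpeedOn hγ).mono fun x hx => ha.trans hx.1)
  have hs : (γ '' Icc a b).Subsingleton := by
    rw [← Set.not_nontrivial_iff]
    exact fun hn => hconn.infinite_of_nontrivial hn ((Set.toFinite {p, q}).subset hsub)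
  have h0 := eVariationOn.constant_on hs
  rw [eVariationOn_Icc_of_hasUnitSpeedOn hγ ha hab.le, ENNReal.ofReal_eq_zero] at h0
  linarith

theorem exists_long_partition {T η : ℝ} (hT : 0 < T) (hη : 0 < η) :
    ∃ (n : ℕ) (u : ℕ → ℝ), Monotone u ∧ (∀ i, u i ∈ Icc 0 T) ∧
      T - η ≤ ∑ i ∈ Finset.range n, dist (γ (u i)) (γ (u (i + 1))) := by
  have hlt : ENNReal.ofReal (T - η) < eVariationOn γ (Icc 0 T) := by
    rw [eVariationOn_Icc_of_hasUnitSpeedOn hγ le_rfl hT.le, sub_zero]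
    exact (ENNReal.ofReal_lt_ofReal_iff hT).2 (by linarith)
  obtain ⟨⟨n, u, hu, hus⟩, h⟩ := lt_iSup_iff.1 hlt
  refine ⟨n, u, hu, hus, ?_⟩
  simp only [edist_dist] at h
  rw [← ENNReal.ofReal_sum_of_nonneg fun _ _ => dist_nonneg] at h
  have := (ENNReal.ofReal_lt_ofReal_iff'.1 h).1.le
  simpa only [dist_comm] using this

end UnitSpeed

/-- The first vertex of a chain after a given point. -/
theorem exists_first_vertex {t : ℕ → ℝ} {n : ℕ} {δ s : ℝ} (hδ : 0 ≤ δ)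
    (hstep : ∀ i < n, t (i + 1) - t i ≤ δ) (h0 : t 0 ≤ s) (hn : s ≤ t n) :
    ∃ i ≤ n, s ≤ t i ∧ t i ≤ s + δ ∧ ∀ j < i, t j < s := by
  classical
  have hex : ∃ i, s ≤ t i := ⟨n, hn⟩
  have hle : Nat.find hex ≤ n := Nat.find_min' hex hn
  refine ⟨Nat.find hex, hle, Nat.find_spec hex, ?_, fun j hj => not_le.1 (Nat.find_min hex hj)⟩
  rcases hk : Nat.find hex with _ | k
  · linarith
  · have h1 := not_le.1 (Nat.find_min hex (m := k) (by omega))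
    have h2 := hstep k (by omega)
    linarith

/-- The length of a chain inscribed in a unit speed curve with small steps is at least that of any
other chain, up to an error proportional to the step. -/
theorem sum_dist_le_sum_dist_add {γ : ℝ → X} (hγ : HasUnitSpeedOn γ (Ici 0)) {T δ : ℝ}
    (hδ : 0 ≤ δ) {m n : ℕ} {u t : ℕ → ℝ} (hu : Monotone u) (huT : ∀ i, u i ∈ Icc 0 T)
    (h0 : t 0 = 0) (hn : t n = T) (hstep : ∀ i < n, t (i + 1) - t i ≤ δ) :
    ∑ i ∈ Finset.range m, dist (γ (u i)) (γ (u (i + 1))) ≤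
      ∑ i ∈ Finset.range n, dist (γ (t i)) (γ (t (i + 1))) + m * (2 * δ) := by
  choose v hvn hv1 hv2 hv3 using fun k => exists_first_vertex hδ hstep
    (h0.trans_le (huT k).1) ((huT k).2.trans_eq hn.symm)
  have hv : Monotone v := monotone_nat_of_le_succ fun k => by
    by_contra! h
    exact absurd (hv3 k _ h) (not_lt.2 ((hu (Nat.le_succ k)).trans (hv1 (k + 1))))
  have hd : ∀ k, dist (γ (u k)) (γ (t (v k))) ≤ δ := fun k =>
    (dist_le_sub_of_hasUnitSpeedOn hγ (huT k).1 (hv1 k)).trans (by linarith [hv2 k])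
  have key : ∀ m : ℕ, ∑ i ∈ Finset.range m, dist (γ (u i)) (γ (u (i + 1))) ≤
      ∑ i ∈ Finset.Ico (v 0) (v m), dist (γ (t i)) (γ (t (i + 1))) + m * (2 * δ) := by
    intro m
    induction m with
    | zero => simp
    | succ m ih =>
      rw [Finset.sum_range_succ, ← Finset.sum_Ico_consecutive _ (hv (Nat.zero_le m))
        (hv (Nat.le_succ m)), Nat.cast_succ]
      have h1 := dist_le_Ico_sum_dist (fun i => γ (t i)) (hv (Nat.le_succ m))
      have h2 := dist_triangle4 (γ (u m)) (γ (t (v m))) (γ (t (v (m + 1)))) (γ (u (m + 1)))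
      have h3 := hd m
      have h4 := hd (m + 1)
      rw [dist_comm] at h4
      simp only [Nat.succ_eq_add_one] at *
      linarith
  refine (key m).trans (add_le_add_left (Finset.sum_le_sum_of_subset_of_nonneg ?_ ?_) _)
  · intro i hi
    rw [Finset.mem_Ico] at hi
    exact Finset.mem_range.2 (hi.2.trans_le (hvn m))
  · exact fun _ _ _ => dist_nonneg

/-- Chains with distinct consecutive vertices and arbitrarily small steps. -/
theorem exists_chain_ne {γ : ℝ → X} (hγ : HasUnitSpeedOn γ (Ici 0)) {h : ℝ} (hh : 0 < h) {N : ℕ}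
    (hN : 2 ≤ N) :
    ∃ t : ℕ → ℝ, t 0 = 0 ∧ t N = N * h ∧ (∀ i < N, t i < t (i + 1)) ∧
      (∀ i < N, t (i + 1) - t i ≤ 2 * h) ∧ ∀ i < N, γ (t i) ≠ γ (t (i + 1)) := by
  choose f hf hfp hfq using fun (i : ℕ) (p : X) => exists_ne_ne_of_hasUnitSpeedOn hγ
    (a := i * h) (b := i * h + h / 2) (by positivity) (by linarith) p (γ (N * h))
  -- Each vertex avoids its predecessor and the endpoint `γ (N * h)`. The parameters stay in
  -- disjoint intervals of length `h / 2`, hence increase.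
  let v : ℕ → ℝ := fun i => Nat.rec 0 (fun i x => f (i + 1) (γ x)) i
  have hv : ∀ i : ℕ, i * h ≤ v i ∧ v i ≤ i * h + h / 2 := by
    intro i
    cases i with
    | zero => simp [v]; linarith
    | succ i => exact hf (i + 1) (γ (v i))
  have hlast : ∀ i, i < N → ¬ i + 1 < N → N = i + 1 := by omega
  refine ⟨fun i => if i < N then v i else N * h, ?_, by simp, ?_, ?_, ?_⟩
  · simp [v]; omega
  all_goals
    intro i hi
    have h1 := hv i
    have h2 := hv (i + 1)
    by_cases hi' : i + 1 < N
    · simp only [hi, hi', if_true]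
      push_cast at h2
      first
        | linarith
        | exact (hfp (i + 1) (γ (v i))).symm
    · simp only [hi, hi', if_true, if_false]
      have e : (N : ℝ) = i + 1 := by rw [hlast i hi hi']; push_cast; rfl
      first
        | (rw [e]; linarith)
        -- As `2 ≤ N`, the vertex before the endpoint is not `v 0`, so it was chosen to avoid the
        -- endpoint.
        | (obtain ⟨j, rfl⟩ : ∃ j, i = j + 1 := ⟨i - 1, by omega⟩
           exact hfq (j + 1) (γ (v j)))

/-- A sufficiently fine chain is almost as long as a fixed nearly optimal partition, and its short
chords are spanned by geodesics. -/
theorem exists_fine_polygon (hX : IsCAT1 X) {γ : ℝ → X} (hγ : HasUnitSpeedOn γ (Ici 0))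
    {T δ η : ℝ} (hT : 0 < T) (hδ : 0 < δ) (hη : 0 < η) :
    ∃ σ : InscribedPolygon γ 0 T, σ.MeshLT δ ∧ (∀ i < σ.n, σ.t (i + 1) - σ.t i ≤ η) ∧
      T - η ≤ ∑ i ∈ Finset.range σ.n, σ.segLength i := by
  obtain ⟨m, u, hu, huT, hsum⟩ := exists_long_partition hγ hT (half_pos hη)
  -- The bounds serve the mesh, the step, the existence of geodesics (`1 < π`) and the length
  -- comparison.
  obtain ⟨ε, hε, hεδ, hεη, hε1, hεm⟩ : ∃ ε > 0, ε < δ ∧ ε ≤ η ∧ ε ≤ 1 ∧ m * (2 * ε) ≤ η / 2 := by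
    have hm : (0 : ℝ) < η / (4 * (m + 1)) := by positivity
    have hpos : 0 < min (min (δ / 2) η) (min 1 (η / (4 * (m + 1)))) := by positivity
    refine ⟨_, hpos, ?_, ?_, ?_, ?_⟩
    · exact ((min_le_left _ _).trans (min_le_left _ _)).trans_lt (half_lt_self hδ)
    · exact (min_le_left _ _).trans (min_le_right _ _)
    · exact (min_le_right _ _).trans (min_le_left _ _)
    · have h1 : min (min (δ / 2) η) (min 1 (η / (4 * (m + 1)))) ≤ η / (4 * (m + 1)) :=
        (min_le_right _ _).trans (min_le_right _ _)
      generalize min (min (δ / 2) η) (min 1 (η / (4 * (m + 1)))) = e at *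
      rw [le_div_iff₀ (by positivity)] at h1
      linarith
  obtain ⟨N, hN⟩ := exists_nat_gt (2 * T / ε)
  have hN' : 2 * T / ε < (N + 2 : ℕ) := hN.trans (by push_cast; linarith)
  have hNpos : (0 : ℝ) < (N + 2 : ℕ) := by positivity
  have hstep : 2 * (T / (N + 2 : ℕ)) ≤ ε := by
    rw [div_lt_iff₀ hε] at hN'
    rw [← mul_div_assoc, div_le_iff₀ hNpos]
    linarith
  obtain ⟨t, h0, hn, hlt, hst, hne⟩ :=
    exists_chain_ne hγ (h := T / (N + 2 : ℕ)) (by positivity) (N := N + 2) (by omega)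
  rw [mul_div_cancel₀ _ hNpos.ne'] at hn
  have hst' : ∀ i < N + 2, t (i + 1) - t i ≤ ε := fun i hi => (hst i hi).trans hstep
  have hnn : ∀ i ≤ N + 2, 0 ≤ t i := by
    intro i
    induction i with
    | zero => exact fun _ => h0.ge
    | succ i ih => exact fun hi => (ih (by omega)).trans (hlt i (by omega)).le
  have hdist : ∀ i < N + 2, dist (γ (t i)) (γ (t (i + 1))) < Real.pi := fun i hi => by
    have h1 := dist_le_sub_of_hasUnitSpeedOn hγ (hnn i hi.le) (hlt i hi).le
    linarith [hst' i hi, Real.pi_gt_three]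
  have : Nonempty X := ⟨γ 0⟩
  choose! seg hseg using fun i hi => hX.exists_geodesic _ _ (hdist i hi)
  refine ⟨⟨N + 2, t, seg, h0, hn, hlt, hne, hseg⟩, ?_, fun i hi => (hst' i hi).trans hεη, ?_⟩
  · intro i hi
    refine lt_of_le_of_lt (Metric.diam_le_of_forall_dist_le hε.le ?_) hεδ
    rintro _ ⟨x, hx, rfl⟩ _ ⟨y, hy, rfl⟩
    have h0 := hnn i (le_of_lt hi)
    have h1 := hst' i hi
    refine (dist_le_abs_of_hasUnitSpeedOn hγ (h0.trans hx.1) (h0.trans hy.1)).trans ?_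
    rw [abs_le]
    simp only at hx hy
    constructor <;> linarith [hx.1, hx.2, hy.1, hy.2]
  · have := sum_dist_le_sum_dist_add hγ hε.le (m := m) hu huT h0 hn hst'
    simp only [InscribedPolygon.segLength]
    linarith

/-! ### Windows of small rotation -/

namespace InscribedPolygon

variable {γ : ℝ → X} {a b : ℝ} (σ : InscribedPolygon γ a b)

theorem t_le_t {i j : ℕ} (hij : i ≤ j) (hj : j ≤ σ.n) : σ.t i ≤ σ.t j := by
  induction j, hij using Nat.le_induction with
  | base => exact le_rfl
  | succ j hij ih => exact (ih (by omega)).trans (σ.lt_succ j (by omega)).le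

theorem t_lt_t {i j : ℕ} (hij : i < j) (hj : j ≤ σ.n) : σ.t i < σ.t j :=
  (σ.lt_succ i (by omega)).trans_le (σ.t_le_t hij hj)

/-- One of the windows `[k * L, (k + 1) * L)` carries at most its share of the total rotation. -/
theorem exists_window_rotation_lt {L κ : ℝ} (hL : 0 < L) {N : ℕ}
    (σ : InscribedPolygon γ 0 (N * L)) (hσ : σ.totalRotation < κ * N) :
    ∃ k < N, ∀ i j, k * L ≤ σ.t i → j ≤ σ.n → σ.t j ≤ (k + 1) * L →
      ∑ m ∈ Finset.Ico i (j - 1), (Real.pi - σ.vertexAngle m) ≤ κ := by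
  have hmaps : ∀ i ∈ Finset.range (σ.n - 1), ⌊σ.t (i + 1) / L⌋₊ ∈ Finset.range N := by
    intro i hi
    rw [Finset.mem_range] at hi
    have h0 := σ.t_le_t (Nat.zero_le (i + 1)) (by omega)
    have h1 := σ.t_lt_t (i := i + 1) (j := σ.n) (by omega) le_rfl
    rw [σ.start_eq] at h0
    rw [σ.end_eq] at h1
    rw [Finset.mem_range, Nat.floor_lt (by positivity), div_lt_iff₀ hL]
    exact h1
  have hsum : ∑ k ∈ Finset.range N, ∑ i ∈ Finset.range (σ.n - 1) with ⌊σ.t (i + 1) / L⌋₊ = k,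
      (Real.pi - σ.vertexAngle i) < ∑ _k ∈ Finset.range N, κ := by
    rw [Finset.sum_fiberwise_of_maps_to hmaps, Finset.sum_const, Finset.card_range, nsmul_eq_mul]
    exact hσ.trans_eq (mul_comm _ _)
  obtain ⟨k, hk, hlt⟩ := Finset.exists_lt_of_sum_lt hsum
  refine ⟨k, Finset.mem_range.1 hk, fun i j hi hj hjk => le_trans ?_ hlt.le⟩
  refine Finset.sum_le_sum_of_subset_of_nonneg ?_ fun m _ _ => σ.rotation_nonneg m
  intro m hm
  rw [Finset.mem_Ico] at hm
  have h1 := σ.t_lt_t (i := i) (j := m + 1) (by omega) (by omega)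
  have h2 := σ.t_lt_t (i := m + 1) (j := j) (by omega) hj
  have h3 : (0 : ℝ) ≤ k * L := by positivity
  rw [Finset.mem_filter, Finset.mem_range]
  refine ⟨by omega, (Nat.floor_eq_iff (div_nonneg (by linarith) hL.le)).2 ⟨?_, ?_⟩⟩
  · rw [le_div_iff₀ hL]; linarith
  · rw [div_lt_iff₀ hL]; linarith

/-- If an inscribed polygon is almost as long as the curve, so are all its subarcs. -/
theorem sub_le_sum_segLength (hγ : HasUnitSpeedOn γ (Ici 0)) (ha : 0 ≤ a) {η : ℝ}
    (hσ : b - a - η ≤ ∑ i ∈ Finset.range σ.n, σ.segLength i) {i j : ℕ} (hij : i ≤ j)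
    (hj : j ≤ σ.n) :
    σ.t j - σ.t i - η ≤ ∑ k ∈ Finset.Ico i j, σ.segLength k ∧
      ∑ k ∈ Finset.Ico i j, σ.segLength k ≤ σ.t j - σ.t i := by
  -- The length deficits are nonnegative with sum at most `η`, so every partial sum lies in `[0,
  -- η]`.
  have hdef : ∀ k ∈ Finset.range σ.n, 0 ≤ (σ.t (k + 1) - σ.t k) - σ.segLength k := fun k hk => by
    have hk' := Finset.mem_range.1 hk
    have h0 := σ.t_le_t (Nat.zero_le k) hk'.le
    rw [σ.start_eq] at h0
    exact sub_nonneg.2 (dist_le_sub_of_hasUnitSpeedOn hγ (ha.trans h0) (σ.lt_succ k hk').le)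
  have hsub : Finset.Ico i j ⊆ Finset.range σ.n := fun k hk =>
    Finset.mem_range.2 ((Finset.mem_Ico.1 hk).2.trans_le hj)
  have h1 := Finset.sum_le_sum_of_subset_of_nonneg hsub fun k hk _ => hdef k hk
  have h2 := Finset.sum_nonneg fun k hk => hdef k (hsub hk)
  rw [Finset.sum_sub_distrib, Finset.sum_Ico_sub _ hij] at h1 h2
  rw [Finset.sum_sub_distrib, Finset.sum_range_sub, σ.start_eq, σ.end_eq] at h1
  constructor <;> linarith

end InscribedPolygon

/-! ### Almost geodesic arcs and their limits -/

/-- A unit speed curve whose total curvature grows sublinearly contains arbitrarily long arcs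
which are arbitrarily close to being local geodesics. -/
theorem exists_almost_geodesic_arc (hX : IsCAT1 X) {γ : ℝ → X} (hγ : HasUnitSpeedOn γ (Ici 0))
    (hτ : Tendsto (fun t : ℝ => totalCurvature γ 0 t / ENNReal.ofReal t) atTop (𝓝 0))
    {L ε : ℝ} (hL : 0 < L) (hε : 0 < ε) :
    ∃ w ≥ 0, ∀ s s', w ≤ s → s ≤ s' → s' ≤ w + L → s' - s ≤ 1 / 2 →
      s' - s - ε ≤ dist (γ s) (γ s') := by
  have hev := hτ.eventually_lt_const (ENNReal.ofReal_pos.2 (show 0 < ε / 2 / L by positivity))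
  have hNL : Tendsto (fun N : ℕ => (N : ℝ) * L) atTop atTop :=
    tendsto_natCast_atTop_atTop.atTop_mul_const hL
  obtain ⟨N, hN, hN1⟩ := ((hNL.eventually hev).and (eventually_ge_atTop 1)).exists
  have hN0 : (0 : ℝ) < N := by exact_mod_cast hN1
  rw [ENNReal.div_lt_iff (Or.inl (ENNReal.ofReal_pos.2 (by positivity)).ne')
    (Or.inl ENNReal.ofReal_ne_top), ← ENNReal.ofReal_mul (by positivity),
    show ε / 2 / L * (N * L) = ε / 2 * N by field_simp, totalCurvature] at hN
  simp only [iInf_lt_iff] at hN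
  obtain ⟨δ, hδ, hlt⟩ := hN
  -- Error budget: rotation `ε / 2` costs `ε` times a length at most `1 / 2`. The length deficit
  -- costs `ε / 10`, and moving each endpoint to a vertex costs at most `2 * (ε / 10)`. The total is
  -- `ε`.
  obtain ⟨σ, hmesh, hstep, hsum⟩ :=
    exists_fine_polygon hX hγ (T := N * L) (η := ε / 10) (by positivity) hδ (by positivity)
  have hrot : σ.totalRotation < ε / 2 * N :=
    (ENNReal.ofReal_lt_ofReal_iff (by positivity)).1
      ((le_iSup₂ (f := fun (σ : InscribedPolygon γ 0 (N * L)) (_ : σ.MeshLT δ) =>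
        ENNReal.ofReal σ.totalRotation) σ hmesh).trans_lt hlt)
  obtain ⟨k, hk, hwin⟩ := σ.exists_window_rotation_lt hL hrot
  have hkL : (0 : ℝ) ≤ k * L := by positivity
  refine ⟨k * L, hkL, fun s s' hs hss hs' hlen => ?_⟩
  rcases lt_or_ge (s' - s) (2 * (ε / 10)) with hshort | hlong
  · linarith [dist_nonneg (x := γ s) (y := γ s')]
  have hkN : (k : ℝ) * L + L ≤ N * L := by
    have : (k : ℝ) + 1 ≤ N := by exact_mod_cast hk
    nlinarith
  have h0 := σ.start_eq
  have hn := σ.end_eq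
  obtain ⟨i, hin, hi1, hi2, -⟩ := exists_first_vertex (s := s) (by positivity) hstep
    (by linarith) (by linarith)
  obtain ⟨j, hjn, hj1, hj2, -⟩ := exists_first_vertex (s := s' - ε / 10) (by positivity) hstep
    (by linarith) (by linarith)
  have hij : i ≤ j := by
    by_contra! h
    linarith [σ.t_lt_t h hin]
  obtain ⟨h1, h2⟩ := σ.sub_le_sum_segLength hγ le_rfl (η := ε / 10) (by linarith) hij hjn
  have hchord := σ.mul_sum_le_dist hX hij hjn (by linarith)
    (hwin i j (by linarith) hjn (by linarith))
  have d1 := dist_le_sub_of_hasUnitSpeedOn hγ (by linarith) hi1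
  have d2 := dist_le_sub_of_hasUnitSpeedOn hγ (s := σ.t j) (t := s') (by linarith) (by linarith)
  have d3 := dist_triangle4 (γ (σ.t i)) (γ s) (γ s') (γ (σ.t j))
  rw [dist_comm (γ (σ.t i)) (γ s), dist_comm (γ s') (γ (σ.t j))] at d3
  nlinarith

/-- A pointwise limit, along an ultrafilter, of translates of a unit speed curve by `u n ≥ n`
approximates segments of the curve uniformly. -/
theorem exists_tendstoUniformlyOn_of_ultrafilter {γ : ℝ → X} (hγ : HasUnitSpeedOn γ (Ici 0))
    {U : Filter ℕ} [U.NeBot] (hU : U ≤ atTop) {u : ℕ → ℝ} (hu : ∀ n : ℕ, (n : ℝ) ≤ u n) {ρ : ℝ → X}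
    (hρ : ∀ s, Tendsto (fun n => γ (u n + s)) U (𝓝 (ρ s)))
    (hlip : ∀ s s', dist (ρ s) (ρ s') ≤ |s - s'|) (a b : ℝ) :
    ∃ v : ℕ → ℝ, (∀ n, 0 ≤ v n + a) ∧
      TendstoUniformlyOn (fun (n : ℕ) (s : ℝ) => γ (v n + s)) ρ atTop (Icc a b) := by
  have key : ∀ δ > 0, ∃ x : ℝ, 0 ≤ x + a ∧ ∀ s ∈ Icc a b, dist (ρ s) (γ (x + s)) < δ := by
    intro δ hδ
    -- A single index serves the whole finite net; the Lipschitz bounds extend the estimate to `[a,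
    -- b]`.
    obtain ⟨F, hFfin, hF⟩ := Metric.totallyBounded_iff.1
      (isCompact_Icc (a := a) (b := b)).totallyBounded (δ / 3) (by positivity)
    have hev : ∀ᶠ n in U, ∀ y ∈ F, dist (ρ y) (γ (u n + y)) < δ / 3 :=
      (eventually_all_finite hFfin).2 fun y _ => by
        have := (hρ y).eventually (Metric.ball_mem_nhds (ρ y) (show 0 < δ / 3 by positivity))
        filter_upwards [this] with n hn
        rw [dist_comm]; exact hn
    obtain ⟨B, hB⟩ : ∃ B : ℝ, ∀ y ∈ F, -y ≤ B := by
      obtain ⟨B, hB⟩ := (hFfin.image fun y => -y).bddAbove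
      exact ⟨B, fun y hy => hB (mem_image_of_mem _ hy)⟩
    have hlarge : ∀ᶠ n : ℕ in U, max (-a) B ≤ n :=
      hU (tendsto_natCast_atTop_atTop.eventually_ge_atTop _)
    obtain ⟨n, hn1, hn2⟩ := (hev.and hlarge).exists
    have hun := hu n
    have hna : -a ≤ n := (le_max_left _ _).trans hn2
    have hnB : B ≤ n := (le_max_right _ _).trans hn2
    refine ⟨u n, by linarith, fun s hs => ?_⟩
    obtain ⟨y, hy, hsy⟩ := mem_iUnion₂.1 (hF hs)
    rw [Metric.mem_ball, Real.dist_eq] at hsy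
    have d1 := hn1 y hy
    have d2 := (hlip s y).trans_lt hsy
    have d3 := dist_le_abs_of_hasUnitSpeedOn hγ (s := u n + y) (t := u n + s)
      (by linarith [hB y hy]) (by linarith [hs.1])
    rw [add_sub_add_left_eq_sub, abs_sub_comm] at d3
    linarith [dist_triangle4 (ρ s) (ρ y) (γ (u n + y)) (γ (u n + s))]
  choose v hv0 hv using fun n : ℕ => key (1 / ((n : ℝ) + 1)) (by positivity)
  refine ⟨v, hv0, Metric.tendstoUniformlyOn_iff.2 fun δ hδ => ?_⟩
  filter_upwards [(tendsto_one_div_add_atTop_nhds_zero_nat (𝕜 := ℝ)).eventually_lt_const hδ]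
    with n hn s hs
  exact (hv n s hs).trans hn

end CatOne

theorem mainTheorem9 {X : Type*} [MetricSpace X] [CompactSpace X] (hX : CatOne.IsCAT1 X)
    (γ : ℝ → X) (hγ : HasUnitSpeedOn γ (Ici 0))
    (hτ : Tendsto (fun t : ℝ => CatOne.totalCurvature γ 0 t / ENNReal.ofReal t) atTop (𝓝 0)) :
    ∃ ρ : ℝ → X, CatOne.IsLocalGeodesicLine ρ ∧
      ∀ a b : ℝ, a ≤ b → ∃ u : ℕ → ℝ, (∀ n, 0 ≤ u n + a) ∧
        TendstoUniformlyOn (fun (n : ℕ) (s : ℝ) => γ (u n + s)) ρ atTop (Icc a b) := by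
  choose w hw0 hw using fun n : ℕ => CatOne.exists_almost_geodesic_arc hX hγ hτ
    (L := 2 * ((n : ℝ) + 1)) (ε := 1 / ((n : ℝ) + 1)) (by positivity) (by positivity)
  -- A nonprincipal ultrafilter gives limits for all real `s` at once. The shift `w n + n` keeps
  -- every `|s| ≤ n` inside the `n`-th window.
  let U : Ultrafilter ℕ := hyperfilter ℕ
  have hU : (U : Filter ℕ) ≤ atTop := by
    rw [← Nat.cofinite_eq_atTop]; exact hyperfilter_le_cofinite
  choose ρ hρ using fun s : ℝ =>
    (isCompact_univ (X := X)).ultrafilter_le_nhds (U.map fun n : ℕ => γ (w n + n + s)) (by simp)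
  have hρ' : ∀ s, Tendsto (fun n : ℕ => γ (w n + n + s)) U (𝓝 (ρ s)) := fun s => (hρ s).2
  have hlarge : ∀ s : ℝ, ∀ᶠ n : ℕ in (U : Filter ℕ), |s| ≤ n := fun s =>
    hU (tendsto_natCast_atTop_atTop.eventually_ge_atTop _)
  have hlip : ∀ s s', dist (ρ s) (ρ s') ≤ |s - s'| := fun s s' => by
    refine le_of_tendsto ((hρ' s).dist (hρ' s')) ?_
    filter_upwards [hlarge s, hlarge s'] with n h1 h2
    have h := CatOne.dist_le_abs_of_hasUnitSpeedOn hγ (s := w n + n + s) (t := w n + n + s')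
      (by linarith [hw0 n, neg_abs_le s]) (by linarith [hw0 n, neg_abs_le s'])
    rwa [add_sub_add_left_eq_sub] at h
  have hge : ∀ s s', s ≤ s' → s' - s ≤ 1 / 2 → s' - s ≤ dist (ρ s) (ρ s') := by
    intro s s' hss hlen
    have hlim : Tendsto (fun n : ℕ => s' - s - 1 / ((n : ℝ) + 1)) U (𝓝 (s' - s - 0)) :=
      (tendsto_const_nhds.sub tendsto_one_div_add_atTop_nhds_zero_nat).mono_left hU
    rw [sub_zero] at hlim
    refine le_of_tendsto_of_tendsto hlim ((hρ' s).dist (hρ' s')) ?_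
    filter_upwards [hlarge s, hlarge s'] with n h1 h2
    have h := hw n (w n + n + s) (w n + n + s') (by linarith [neg_abs_le s]) (by linarith)
      (by linarith [le_abs_self s']) (by linarith)
    rwa [add_sub_add_left_eq_sub] at h
  -- Radius `1 / 4` keeps the two parameters within `1 / 2` of each other.
  refine ⟨ρ, fun t => ⟨1 / 4, by norm_num, fun s hs s' hs' => (hlip s s').antisymm ?_⟩,
    fun a b _ => CatOne.exists_tendstoUniformlyOn_of_ultrafilter hγ hU
      (fun n : ℕ => by linarith [hw0 n]) hρ' hlip a b⟩
  rcases le_total s s' with h | h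
  · rw [abs_sub_comm, abs_of_nonneg (sub_nonneg.2 h)]
    exact hge s s' h (by linarith [hs.1, hs'.2])
  · rw [dist_comm, abs_of_nonneg (sub_nonneg.2 h)]
    exact hge s' s h (by linarith [hs'.1, hs.2])
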